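/- Let $K$ be a compact Hausdorff space and let $T : K \to K$ be a homeomorphism. Let $M(K)$ be the space of regular Borel probability measures on $K$ with the weak$^*$ topology (the coarsest topology for which $\mu \mapsto \int_K f\, d\mu$ is continuous for every continuous function $f$ on $K$), and let $T_* : M(K) \to M(K)$, $T_*\mu (B) = \mu (T^{-1} B)$, be the induced homeomorphism. Then $T$ is null if and only if $T_*$ is null. Here a homeomorphism $S : X \to X$ of a compact Hausdorff space is called null if its sequence topological entropy is zero for all sequences, that is, if $$\sup_{\mathcal{W}} \limsup_{n\to\infty} \frac1n \log N\big( S^{-s_1}\mathcal{W} \vee S^{-s_2}\mathcal{W} \vee \cdots \vee S^{-s_n}\mathcal{W} \big) = 0$$ for every sequence $0\le s_1 < s_2 < \cdots$ of integers, where $\mathcal{W}$ ranges over the finite open covers of $X$ and $N(\cdot)$ denotes the smallest cardinality of a subcover (with $\log 0 := 0$ if $X=\emptyset$). -/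

import Mathlib

open Set Filter Topology MeasureTheory

noncomputable section

namespace SeqEntropy

section Entropy

variable {X : Type*} [TopologicalSpace X]

/-- `W` is a finite open cover of `X`. -/
def IsFiniteOpenCover (W : Set (Set X)) : Prop :=
  W.Finite ∧ (∀ U ∈ W, IsOpen U) ∧ ⋃₀ W = univ

/-- `N(C)`: the smallest cardinality of a subcover of the cover `C`. (It is only used for finite
covers, for which a finite subcover exists.) -/
def minSubcoverCard {X : Type*} (C : Set (Set X)) : ℕ :=
  sInf {k : ℕ | ∃ F : Finset (Set X), (F : Set (Set X)) ⊆ C ∧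
    ⋃₀ (F : Set (Set X)) = univ ∧ F.card = k}

/-- The join `T^{-s 0} W ∨ T^{-s 1} W ∨ ⋯ ∨ T^{-s (n-1)} W`: its members are the sets
`⋂ i < n, T^{-s i} (U i)` with all `U i ∈ W`. -/
def seqJoin (T : X ≃ₜ X) (s : ℕ → ℕ) (W : Set (Set X)) (n : ℕ) : Set (Set X) :=
  {V | ∃ U : Fin n → Set X, (∀ i, U i ∈ W) ∧ V = ⋂ i : Fin n, (⇑T)^[s i] ⁻¹' U i}

/-- The sequence entropy of `T` along `s` with respect to the cover `W`,
`limsup_n (1/n) log N(T^{-s 0} W ∨ ⋯ ∨ T^{-s (n-1)} W)`. -/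
def seqEntropyCover (T : X ≃ₜ X) (s : ℕ → ℕ) (W : Set (Set X)) : EReal :=
  limsup (fun n : ℕ => ((Real.log (minSubcoverCard (seqJoin T s W n)) / n : ℝ) : EReal)) atTop

/-- The sequence topological entropy of `T` along `s`: the supremum over all finite open covers. -/
def seqEntropy (T : X ≃ₜ X) (s : ℕ → ℕ) : EReal :=
  ⨆ (W : Set (Set X)) (_ : IsFiniteOpenCover W), seqEntropyCover T s W

/-- `T` is null: its sequence topological entropy vanishes along every (strictly increasing)
sequence of nonnegative integers. -/
def IsNull (T : X ≃ₜ X) : Prop :=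
  ∀ s : ℕ → ℕ, StrictMono s → seqEntropy T s = 0

end Entropy

section Measures

variable (K : Type*) [TopologicalSpace K] [MeasurableSpace K] [BorelSpace K]

/-- The space `M(K)` of regular Borel probability measures on `K`. -/
def ProbSpace : Type _ :=
  {μ : ProbabilityMeasure K // (μ : Measure K).Regular}

/-- The weak* topology on `M(K)`, i.e. the one of convergence against continuous functions
(for compact `K` all of these are bounded). -/
instance : TopologicalSpace (ProbSpace K) :=
  inferInstanceAs (TopologicalSpace {μ : ProbabilityMeasure K // (μ : Measure K).Regular})

variable {K}

/-- Push-forward of regular Borel probability measures under a homeomorphism. -/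
def pushforward (T : K ≃ₜ K) (μ : ProbSpace K) : ProbSpace K :=
  ⟨μ.1.map T.continuous.measurable.aemeasurable, by
    have := μ.2
    exact Measure.Regular.map T⟩

theorem pushforward_continuous (T : K ≃ₜ K) : Continuous (pushforward T) :=
  ((ProbabilityMeasure.continuous_map T.continuous).comp continuous_subtype_val).subtype_mk _

theorem pushforward_pushforward (S T : K ≃ₜ K) (h : ∀ x, S (T x) = x) (μ : ProbSpace K) :
    pushforward S (pushforward T μ) = μ := by
  apply Subtype.ext
  apply Subtype.ext
  change Measure.map S (Measure.map T (μ.1 : Measure K)) = (μ.1 : Measure K)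
  rw [Measure.map_map S.continuous.measurable T.continuous.measurable]
  have : (⇑S ∘ ⇑T) = id := funext h
  rw [this, Measure.map_id]

/-- The homeomorphism `μ ↦ T_* μ` of `M(K)` induced by a homeomorphism `T` of `K`. -/
def inducedHomeo (T : K ≃ₜ K) : ProbSpace K ≃ₜ ProbSpace K where
  toFun := pushforward T
  invFun := pushforward T.symm
  left_inv := pushforward_pushforward T.symm T T.symm_apply_apply
  right_inv := pushforward_pushforward T T.symm T.apply_symm_apply
  continuous_toFun := pushforward_continuous T
  continuous_invFun := pushforward_continuous T.symm

end Measures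

end SeqEntropy

end

/-! Point masses embed `K` equivariantly in `M(K)`. A partition of unity subordinate to a cover `U`
of `K` gives the open sets `∫ ρ_u dμ > 0` of `M(K)`, whose traces on point masses refine `U`. Hence
nullness passes from `T_*` to `T`.

Conversely, a cover of `M(K)` is controlled by finitely many test functions, `k` say, up to an error
`ε`. Membership in the `n`-fold join is then decided by the `kn` integrals of `f ∘ T^{s_i}`. By
Maurey's empirical method (`exists_sum_sq_sum_sub_integral_le`), an average over `L` points
approximates all but `O(n/L)` of them, with `L` independent of `n`. Recording only the cells of
these points in a minimal subcover of a join on `K` costs `L log N = o(n)`. The exceptional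
integrals are stored in rounded form, and such sparse tables number at most `exp(ηn)` once `L` is
large (`log_card_sparse_le`). So `μ` has a code with `exp(o(n))` values
(`minSubcoverCard_inducedHomeo_le`). -/

namespace SeqEntropy

/-! ### Empirical approximation and counting of sparse tables -/

open Finset in
/-- Greedy form of Maurey's empirical method. -/
theorem exists_sum_sq_sum_sub_integral_le {Ω ι : Type*} [MeasurableSpace Ω] [Fintype ι]
    (μ : Measure Ω) [IsProbabilityMeasure μ] (F : ι → Ω → ℝ) (hF : ∀ c, Integrable (F c) μ)
    {M : ℝ} (hM : ∀ c x, |F c x| ≤ M) (L : ℕ) :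
    ∃ x : Fin L → Ω, ∑ c, (∑ l, (F c (x l) - ∫ y, F c y ∂μ)) ^ 2
      ≤ L * (Fintype.card ι * (2 * M) ^ 2) := by
  induction L with
  | zero => exact ⟨Fin.elim0, by simp⟩
  | succ L ih =>
    obtain ⟨x, hx⟩ := ih
    set S : ι → ℝ := fun c => ∑ l, (F c (x l) - ∫ y, F c y ∂μ) with hS
    have hint : ∀ c, Integrable (fun z => S c * (F c z - ∫ y, F c y ∂μ)) μ := fun c =>
      ((hF c).sub (integrable_const _)).const_mul _
    have h0 : ∫ z, ∑ c, S c * (F c z - ∫ y, F c y ∂μ) ∂μ = 0 := by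
      rw [integral_finsetSum _ fun c _ => hint c]
      refine sum_eq_zero fun c _ => ?_
      rw [integral_const_mul, integral_sub (hF c) (integrable_const _)]
      simp
    -- The cross term has mean zero, so some `z` makes it nonpositive; only the diagonal term is
    -- then added to the error.
    obtain ⟨z, hz⟩ := exists_le_integral (μ := μ) (integrable_finsetSum univ fun c _ => hint c)
    rw [h0] at hz
    have hdev : ∀ c, (F c z - ∫ y, F c y ∂μ) ^ 2 ≤ (2 * M) ^ 2 := fun c => by
      have h1 : |∫ y, F c y ∂μ| ≤ M := by
        simpa using norm_integral_le_of_norm_le_const (μ := μ) (f := F c) (C := M) (.of_forall (hM c))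
      refine sq_le_sq' ?_ ?_ <;> linarith [abs_le.1 h1, abs_le.1 (hM c z)]
    refine ⟨Fin.snoc x z, ?_⟩
    calc ∑ c, (∑ l, (F c ((Fin.snoc x z : Fin (L + 1) → Ω) l) - ∫ y, F c y ∂μ)) ^ 2
        = ∑ c, (S c ^ 2 + 2 * (S c * (F c z - ∫ y, F c y ∂μ))
            + (F c z - ∫ y, F c y ∂μ) ^ 2) := by
          refine sum_congr rfl fun c _ => ?_
          rw [Fin.sum_univ_castSucc]
          simp only [Fin.snoc_castSucc, Fin.snoc_last, hS]
          ring
      _ = ∑ c, S c ^ 2 + 2 * ∑ c, S c * (F c z - ∫ y, F c y ∂μ)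
            + ∑ c, (F c z - ∫ y, F c y ∂μ) ^ 2 := by
          rw [sum_add_distrib, sum_add_distrib, mul_sum]
      _ ≤ L * (Fintype.card ι * (2 * M) ^ 2) + 2 * 0 + Fintype.card ι * (2 * M) ^ 2 := by
          have : ∑ c, (F c z - ∫ y, F c y ∂μ) ^ 2 ≤ Fintype.card ι * (2 * M) ^ 2 := by
            simpa using sum_le_sum (s := univ) fun c _ => hdev c
          gcongr
      _ = _ := by push_cast; ring

open Finset in
/-- Generating function bound for the number of partial functions with small domain. -/
theorem card_sparse_mul_pow_le {ι : Type*} [Fintype ι] (Q b : ℕ) {t : ℝ}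
    (ht0 : 0 ≤ t) (ht1 : t ≤ 1) :
    (Nat.card {h : ι → Option (Fin Q) // #{c | h c ≠ none} ≤ b} : ℝ) * t ^ b
      ≤ (1 + Q * t) ^ Fintype.card ι := by
  classical
  -- Weight each table by `t` to the size of its domain: the total factorises, and a sparse table
  -- weighs at least `t ^ b`.
  have hsum : ∑ h : ι → Option (Fin Q), ∏ c, (if h c ≠ none then t else 1)
      = (1 + Q * t) ^ Fintype.card ι := by
    rw [← Fintype.prod_sum (fun (_ : ι) (o : Option (Fin Q)) => if o ≠ none then t else 1)]
    simp [Fintype.sum_option]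
  rw [← hsum, Nat.card_eq_fintype_card, Fintype.card_subtype, ← nsmul_eq_mul, ← sum_const]
  refine (sum_le_sum (g := fun h : ι → Option (Fin Q) => ∏ c, (if h c ≠ none then t else 1))
    fun h hh => ?_).trans (sum_le_sum_of_subset_of_nonneg (subset_univ _) fun h _ _ => ?_)
  · rw [← prod_filter, prod_const]
    exact pow_le_pow_of_le_one ht0 ht1 (mem_filter.1 hh).2
  · exact prod_nonneg fun c _ => by split_ifs <;> simp [ht0]

/-! ### Subcover numbers and entropy of covers -/

section Covers

variable {X : Type*}

/-- One member of `C` for each attained code value already covers. Both comparisons of joins rest on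
this. -/
theorem minSubcoverCard_le_of_code {C : Set (Set X)} {α : Type*} [Finite α] (code : X → α)
    (h : ∀ x, ∃ V ∈ C, ∀ y, code y = code x → y ∈ V) :
    minSubcoverCard C ≤ Nat.card α := by
  classical
  have := Fintype.ofFinite α
  rw [Nat.card_eq_fintype_card]
  choose V hV hmem using h
  let r : Set.range code → Set X := fun a => V a.2.choose
  have hr : ∀ a : Set.range code, code a.2.choose = a := fun a => a.2.choose_spec
  calc minSubcoverCard C ≤ (Finset.univ.image r).card := by
        refine Nat.sInf_le ⟨_, ?_, ?_, rfl⟩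
        · intro U hU
          obtain ⟨a, -, rfl⟩ := Finset.mem_image.1 (Finset.mem_coe.1 hU)
          exact hV _
        · refine Set.eq_univ_of_forall fun y => ?_
          exact ⟨r ⟨code y, y, rfl⟩, by simp, hmem _ _ (hr ⟨code y, y, rfl⟩).symm⟩
    _ ≤ Fintype.card (Set.range code) := Finset.card_image_le
    _ ≤ Fintype.card α := Fintype.card_subtype_le _

theorem exists_subcover_card_eq {C : Set (Set X)} (hC : C.Finite) (hcov : ⋃₀ C = univ) :
    ∃ F : Finset (Set X), (F : Set (Set X)) ⊆ C ∧ ⋃₀ (F : Set (Set X)) = univ ∧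
      F.card = minSubcoverCard C :=
  Nat.sInf_mem (s := {k : ℕ | ∃ F : Finset (Set X), (F : Set (Set X)) ⊆ C ∧
    ⋃₀ (F : Set (Set X)) = univ ∧ F.card = k})
    ⟨_, hC.toFinset, by simp, by simpa using hcov, rfl⟩

variable [TopologicalSpace X]

theorem IsFiniteOpenCover.finite_seqJoin {W : Set (Set X)} (hW : IsFiniteOpenCover W)
    (T : X ≃ₜ X) (s : ℕ → ℕ) (n : ℕ) : (seqJoin T s W n).Finite := by
  refine ((Set.Finite.pi' fun _ : Fin n => hW.1).image
    fun U => ⋂ i : Fin n, (⇑T)^[s i] ⁻¹' U i).subset ?_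
  rintro V ⟨U, hU, rfl⟩
  exact ⟨U, hU, rfl⟩

theorem IsFiniteOpenCover.sUnion_seqJoin {W : Set (Set X)} (hW : IsFiniteOpenCover W)
    (T : X ≃ₜ X) (s : ℕ → ℕ) (n : ℕ) : ⋃₀ seqJoin T s W n = univ := by
  refine Set.eq_univ_of_forall fun x => ?_
  have : ∀ y, ∃ U ∈ W, y ∈ U := fun y => mem_sUnion.1 (hW.2.2 ▸ mem_univ y)
  choose U hU hmem using this
  exact ⟨_, ⟨fun i => U ((⇑T)^[s i] x), fun _ => hU _, rfl⟩, mem_iInter.2 fun _ => hmem _⟩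

theorem seqEntropyCover_le_zero_iff (T : X ≃ₜ X) (s : ℕ → ℕ) (W : Set (Set X)) :
    seqEntropyCover T s W ≤ 0 ↔
      ∀ η : ℝ, 0 < η → ∀ᶠ n : ℕ in atTop,
        Real.log (minSubcoverCard (seqJoin T s W n)) / n ≤ η := by
  rw [seqEntropyCover, limsup_le_iff']
  constructor
  · intro h η hη
    filter_upwards [h η (by exact_mod_cast hη)] with n hn
    exact_mod_cast hn
  · intro h y hy
    obtain ⟨η, h0, h1⟩ := EReal.lt_iff_exists_real_btwn.1 hy
    filter_upwards [h η (by exact_mod_cast h0)] with n hn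
    exact le_trans (by exact_mod_cast hn) h1.le

theorem seqEntropyCover_nonneg (T : X ≃ₜ X) (s : ℕ → ℕ) (W : Set (Set X)) :
    0 ≤ seqEntropyCover T s W := by
  refine le_limsup_of_frequently_le (Eventually.frequently (.of_forall fun n => ?_))
  have : 0 ≤ Real.log (minSubcoverCard (seqJoin T s W n)) / n :=
    div_nonneg (Real.log_natCast_nonneg _) (Nat.cast_nonneg _)
  exact_mod_cast this

theorem seqEntropy_eq_zero_iff (T : X ≃ₜ X) (s : ℕ → ℕ) :
    seqEntropy T s = 0 ↔ ∀ W : Set (Set X), IsFiniteOpenCover W → seqEntropyCover T s W ≤ 0 := by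
  constructor
  · intro h W hW
    exact h ▸ le_iSup₂ (f := fun W (_ : IsFiniteOpenCover W) => seqEntropyCover T s W) W hW
  · intro h
    have hu : IsFiniteOpenCover ({univ} : Set (Set X)) := by simp [IsFiniteOpenCover]
    exact le_antisymm (iSup₂_le h) ((seqEntropyCover_nonneg T s _).trans
      (le_iSup₂ (f := fun W (_ : IsFiniteOpenCover W) => seqEntropyCover T s W) _ hu))

theorem seqEntropyCover_mono_of_minSubcoverCard_le {Y : Type*} [TopologicalSpace Y] {S : X ≃ₜ X}
    {T : Y ≃ₜ Y} {s : ℕ → ℕ} {V : Set (Set X)} {W : Set (Set Y)}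
    (h : ∀ n, minSubcoverCard (seqJoin S s V n) ≤ minSubcoverCard (seqJoin T s W n)) :
    seqEntropyCover S s V ≤ seqEntropyCover T s W := by
  refine limsup_le_limsup (.of_forall fun n => EReal.coe_le_coe_iff.2 ?_)
  refine div_le_div_of_nonneg_right ?_ (Nat.cast_nonneg _)
  rcases Nat.eq_zero_or_pos (minSubcoverCard (seqJoin S s V n)) with h0 | h0
  · rw [h0]
    simpa using Real.log_natCast_nonneg _
  · exact Real.log_le_log (by exact_mod_cast h0) (by exact_mod_cast h n)

/-- Sequence entropy relative to covers does not increase under pulling back along an equivariant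
map. -/
theorem seqEntropyCover_le_of_semiconj {Y : Type*} [TopologicalSpace Y] {S : X ≃ₜ X} {T : Y ≃ₜ Y}
    {s : ℕ → ℕ} {φ : X → Y} (hφ : Function.Semiconj φ S T) {V : Set (Set X)} {W : Set (Set Y)}
    (hW : IsFiniteOpenCover W) (hVW : ∀ U ∈ W, ∃ U' ∈ V, φ ⁻¹' U ⊆ U') :
    seqEntropyCover S s V ≤ seqEntropyCover T s W := by
  refine seqEntropyCover_mono_of_minSubcoverCard_le fun n => ?_
  obtain ⟨F, hFsub, hFcov, hFcard⟩ :=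
    exists_subcover_card_eq (hW.finite_seqJoin T s n) (hW.sUnion_seqJoin T s n)
  have hmem : ∀ x : X, ∃ G : F, φ x ∈ (G : Set Y) := fun x => by
    obtain ⟨G, hG, hx⟩ := mem_sUnion.1 (hFcov ▸ mem_univ (φ x) : φ x ∈ ⋃₀ (F : Set (Set Y)))
    exact ⟨⟨G, hG⟩, hx⟩
  choose code hcode using hmem
  rw [← hFcard, ← Fintype.card_coe, ← Nat.card_eq_fintype_card]
  refine minSubcoverCard_le_of_code code fun x => ?_
  obtain ⟨U, hU, hUeq⟩ := hFsub (code x).2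
  choose U' hU' hsub using fun i => hVW (U i) (hU i)
  refine ⟨_, ⟨U', hU', rfl⟩, fun y hy => mem_iInter.2 fun i => hsub i ?_⟩
  have hyU : φ y ∈ ⋂ i : Fin n, (⇑T)^[s i] ⁻¹' U i := hUeq ▸ hy ▸ hcode y
  rw [mem_preimage, hφ.iterate_right (s i) y]
  exact mem_iInter.1 hyU i

end Covers

/-! ### The weak* topology and its compactness -/

section Integrals

variable {K : Type*} [TopologicalSpace K] [MeasurableSpace K] [BorelSpace K]

theorem integral_pushforward_iterate (T : K ≃ₜ K) (m : ℕ) (μ : ProbSpace K) (f : K → ℝ) :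
    ∫ x, f x ∂(((inducedHomeo T)^[m] μ).1 : Measure K) = ∫ x, f ((⇑T)^[m] x) ∂(μ.1 : Measure K) := by
  induction m generalizing μ with
  | zero => rfl
  | succ m ih =>
    rw [Function.iterate_succ_apply, ih]
    exact (T.measurableEmbedding.integral_map _)

variable [CompactSpace K]

theorem integrable_continuousMap (μ : ProbSpace K) (f : C(K, ℝ)) :
    Integrable f (μ.1 : Measure K) :=
  (BoundedContinuousFunction.mkOfCompact f).integrable _

variable (K) in
/-- A measure as a functional on the continuous functions. -/
noncomputable def integralMap (μ : ProbSpace K) (f : C(K, ℝ)) : ℝ := ∫ x, f x ∂(μ.1 : Measure K)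

theorem tendsto_probSpace_iff {γ : Type*} {F : Filter γ} {u : γ → ProbSpace K} {μ : ProbSpace K} :
    Tendsto u F (𝓝 μ) ↔
      ∀ f : C(K, ℝ), Tendsto (fun i => integralMap K (u i) f) F (𝓝 (integralMap K μ f)) := by
  rw [show Tendsto u F (𝓝 μ) ↔ Tendsto (fun i => (u i).1) F (𝓝 μ.1) from
    IsInducing.subtypeVal.tendsto_nhds_iff, ProbabilityMeasure.tendsto_iff_forall_integral_tendsto]
  exact (ContinuousMap.equivBoundedOfCompact ..).symm.forall_congr_left

variable (K) in
theorem isInducing_integralMap : IsInducing (integralMap K) := by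
  refine isInducing_iff_nhds.2 fun μ => le_antisymm ?_ ?_
  · rw [← tendsto_iff_comap, tendsto_pi_nhds]
    exact tendsto_probSpace_iff.1 tendsto_id
  · exact tendsto_probSpace_iff.2 (tendsto_pi_nhds.1 tendsto_comap)

instance [T2Space K] : CompactSpace (ProbSpace K) := by
  refine ⟨isCompact_iff_ultrafilter_le_nhds'.2 fun F _ => ?_⟩
  obtain ⟨μ, -, hμ⟩ := isCompact_univ.ultrafilter_le_nhds
    (F.map fun ν : ProbSpace K => ν.1) (by simp)
  -- The limit `μ` need not be regular; a regular measure with the same integrals of continuous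
  -- functions is a limit as well.
  obtain ⟨ν, hreg, hfin, hν⟩ := Measure.exists_regular_eq_of_compactSpace (μ : Measure K)
  have hprob : IsProbabilityMeasure ν := by
    refine ⟨?_⟩
    have := hν 1
    simp only [BoundedContinuousFunction.coe_one, Pi.one_apply, integral_const, smul_eq_mul,
      mul_one, probReal_univ] at this
    simpa [Measure.real, ENNReal.toReal_eq_one_iff] using this.symm
  refine ⟨⟨⟨ν, hprob⟩, hreg⟩, mem_univ _, ?_⟩
  refine tendsto_probSpace_iff (u := id).2 fun f => ?_
  have h := ProbabilityMeasure.tendsto_iff_forall_integral_tendsto.1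
    (show Tendsto (fun ν : ProbSpace K => ν.1) F (𝓝 μ) from hμ)
    (BoundedContinuousFunction.mkOfCompact f)
  rwa [hν] at h

/-- Lebesgue number lemma for the weak* topology. -/
theorem exists_finset_forall_integral_close [T2Space K] {W : Set (Set (ProbSpace K))}
    (hW : IsFiniteOpenCover W) :
    ∃ (A : Finset C(K, ℝ)) (ε : ℝ), 0 < ε ∧ ∀ μ, ∃ V ∈ W, ∀ ν,
      (∀ f ∈ A, |integralMap K μ f - integralMap K ν f| < ε) → ν ∈ V := by
  choose O hO hOV using fun V : W => (isInducing_integralMap K).isOpen_iff.1 (hW.2.1 V V.2)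
  obtain ⟨E, hE, hsub⟩ := lebesgue_number_lemma (U := O)
    (isCompact_range (isInducing_integralMap K).continuous) hO (by
      rintro - ⟨μ, rfl⟩
      obtain ⟨V, hV, hμ⟩ := mem_sUnion.1 (hW.2.2 ▸ mem_univ μ)
      exact mem_iUnion.2 ⟨⟨V, hV⟩, by rwa [← mem_preimage, hOV]⟩)
  -- A basic entourage of the product restricts finitely many coordinates, which become the test
  -- functions.
  rw [Pi.uniformity] at hE
  obtain ⟨⟨I, r⟩, ⟨hI, hr⟩, hIr⟩ := (HasBasis.iInf' fun f : C(K, ℝ) =>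
    Metric.uniformity_basis_dist.comap
      fun a : (C(K, ℝ) → ℝ) × (C(K, ℝ) → ℝ) => (a.1 f, a.2 f)).mem_iff.1 hE
  obtain ⟨ε, hε0, hε⟩ : ∃ ε > 0, ∀ f ∈ I, ε < r f := by
    have h : ∀ᶠ ε : ℝ in 𝓝[>] 0, ∀ f ∈ I, ε < r f :=
      (eventually_all_finite hI).2 fun f hf => eventually_nhdsWithin_of_eventually_nhds (eventually_lt_nhds (hr f hf))
    obtain ⟨ε, h1, h2⟩ := (h.and self_mem_nhdsWithin).exists
    exact ⟨ε, h2, h1⟩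
  refine ⟨hI.toFinset, ε, hε0, fun μ => ?_⟩
  obtain ⟨V, hV⟩ := hsub _ ⟨μ, rfl⟩
  refine ⟨V, V.2, fun ν hν => ?_⟩
  rw [← hOV, mem_preimage]
  refine hV (hIr (mem_iInter₂.2 fun f hf => ?_))
  exact (hν f (by simpa using hf)).trans (hε f hf)

omit [MeasurableSpace K] [BorelSpace K] in
theorem exists_cover_small_oscillation (A : Finset C(K, ℝ)) {δ : ℝ} (hδ : 0 < δ) :
    ∃ U : Set (Set K), IsFiniteOpenCover U ∧
      ∀ u ∈ U, ∀ x ∈ u, ∀ y ∈ u, ∀ f ∈ A, |f x - f y| < δ := by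
  let B : K → Set K := fun x => ⋂ f ∈ A, {y | |f y - f x| < δ / 2}
  have hB : ∀ x, IsOpen (B x) := fun x => isOpen_biInter_finset fun f _ =>
    isOpen_lt (by fun_prop) continuous_const
  obtain ⟨t, ht⟩ := isCompact_univ.elim_finite_subcover B hB
    fun x _ => mem_iUnion.2 ⟨x, by simp [B, hδ]⟩
  refine ⟨B '' t, ⟨t.finite_toSet.image B, ?_, ?_⟩, ?_⟩
  · rintro - ⟨x, -, rfl⟩
    exact hB x
  · rw [sUnion_image]
    exact univ_subset_iff.1 ht
  · rintro - ⟨z, -, rfl⟩ x hx y hy f hf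
    have h1 := mem_iInter₂.1 hx f hf
    have h2 := mem_iInter₂.1 hy f hf
    rw [mem_ofPred_eq, abs_lt] at h1 h2
    rw [abs_lt]
    constructor <;> linarith

end Integrals

/-! ### Point masses: from `T_*` to `T` -/

section Dirac

variable {K : Type*} [TopologicalSpace K] [T2Space K] [MeasurableSpace K] [BorelSpace K]

theorem regular_dirac (x : K) : (Measure.dirac x).Regular where
  outerRegular A hA r hr := by
    by_cases hx : x ∈ A
    · exact ⟨univ, subset_univ _, isOpen_univ, by simpa [hx] using hr⟩
    · refine ⟨{x}ᶜ, by simpa using hx, isOpen_compl_singleton, ?_⟩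
      rw [Measure.dirac_apply' _ (measurableSet_singleton x).compl]
      simpa using pos_of_gt hr
  innerRegular U hU r hr := by
    by_cases hx : x ∈ U
    · exact ⟨{x}, by simpa using hx, isCompact_singleton, by simpa [hx] using hr⟩
    · simp [Measure.dirac_apply' _ hU.measurableSet, hx] at hr

/-- The point mass at `x`. -/
noncomputable def diracMeasure (x : K) : ProbSpace K :=
  ⟨⟨Measure.dirac x, inferInstance⟩, regular_dirac x⟩

theorem semiconj_diracMeasure (T : K ≃ₜ K) :
    Function.Semiconj diracMeasure T (inducedHomeo T) := fun x => by
  refine Subtype.ext (Subtype.ext ?_)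
  exact (Measure.map_dirac' T.continuous.measurable x).symm

variable [CompactSpace K]

theorem isNull_of_isNull_inducedHomeo {T : K ≃ₜ K} (h : IsNull (inducedHomeo T)) : IsNull T := by
  intro s hs
  refine (seqEntropy_eq_zero_iff T s).2 fun U hU => ?_
  have := hU.1.to_subtype
  have := Fintype.ofFinite U
  obtain ⟨ρ, hρ⟩ := PartitionOfUnity.exists_isSubordinate isClosed_univ (fun u : U => (u : Set K))
    (fun u => hU.2.1 u u.2) (by rw [← sUnion_eq_iUnion, hU.2.2])
  let V : U → Set (ProbSpace K) := fun u => {μ | 0 < integralMap K μ (ρ u)}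
  have hV : IsFiniteOpenCover (range V) := by
    refine ⟨finite_range V, ?_, ?_⟩
    · rintro - ⟨u, rfl⟩
      exact isOpen_lt continuous_const
        ((continuous_apply (ρ u)).comp (isInducing_integralMap K).continuous)
    · refine eq_univ_of_forall fun μ => ?_
      have hsum : ∑ u, integralMap K μ (ρ u) = 1 := by
        simp only [integralMap]
        rw [← integral_finsetSum _ fun u _ => integrable_continuousMap μ (ρ u)]
        have : ∀ x, ∑ u, ρ u x = 1 := fun x => by
          rw [← finsum_eq_sum_of_fintype, ρ.sum_eq_one (mem_univ x)]
        simp [this]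
      -- The integrals of the partition of unity sum to `1`, so one is positive.
      obtain ⟨u, -, hu⟩ := Finset.exists_lt_of_sum_lt (s := Finset.univ) (f := fun _ : U => (0 : ℝ))
        (g := fun u => integralMap K μ (ρ u)) (by simp [hsum])
      exact ⟨V u, ⟨u, rfl⟩, hu⟩
  refine (seqEntropyCover_le_of_semiconj (semiconj_diracMeasure T) hV ?_).trans
    ((seqEntropy_eq_zero_iff _ s).1 (h s hs) _ hV)
  rintro - ⟨u, rfl⟩
  refine ⟨u, u.2, fun x hx => hρ u (subset_tsupport _ ?_)⟩
  have hx' : 0 < ∫ y, ρ u y ∂(Measure.dirac x) := hx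
  rw [integral_dirac] at hx'
  exact hx'.ne'

end Dirac

/-! ### Logarithmic and rounding estimates -/

open Finset in
theorem log_card_sparse_le {ι : Type*} [Fintype ι] (Q b : ℕ) {t : ℝ}
    (ht0 : 0 < t) (ht1 : t ≤ 1) :
    Real.log (Nat.card {h : ι → Option (Fin Q) // #{c | h c ≠ none} ≤ b})
      ≤ Fintype.card ι * (Q * t) + b * -Real.log t := by
  have hlog : 0 ≤ -Real.log t := neg_nonneg.2 (Real.log_nonpos ht0.le ht1)
  rcases Nat.eq_zero_or_pos
    (Nat.card {h : ι → Option (Fin Q) // #{c | h c ≠ none} ≤ b}) with h0 | h0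
  · rw [h0]
    simp only [Nat.cast_zero, Real.log_zero]
    positivity
  · have hpos : (0 : ℝ) < Nat.card {h : ι → Option (Fin Q) // #{c | h c ≠ none} ≤ b} := by
      exact_mod_cast h0
    have h1 := Real.log_le_log (by positivity) (card_sparse_mul_pow_le (ι := ι) Q b ht0.le ht1)
    rw [Real.log_mul hpos.ne' (by positivity), Real.log_pow, Real.log_pow] at h1
    have h2 : Real.log (1 + Q * t) ≤ Q * t := by
      linarith [Real.log_le_sub_one_of_pos (show 0 < 1 + Q * t by positivity)]
    have h3 := mul_le_mul_of_nonneg_left h2 (Nat.cast_nonneg (α := ℝ) (Fintype.card ι))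
    linarith

theorem abs_sub_lt_of_floor_eq {M δ a b : ℝ} (hδ : 0 < δ) (ha : |a| ≤ M) (hb : |b| ≤ M)
    (h : ⌊(a + M) / δ⌋₊ = ⌊(b + M) / δ⌋₊) : |a - b| < δ := by
  have ha' : 0 ≤ (a + M) / δ := div_nonneg (by linarith [abs_le.1 ha]) hδ.le
  have hb' : 0 ≤ (b + M) / δ := div_nonneg (by linarith [abs_le.1 hb]) hδ.le
  have h1 := Nat.floor_le ha'
  have h2 := Nat.lt_floor_add_one ((a + M) / δ)
  have h3 := Nat.floor_le hb'
  have h4 := Nat.lt_floor_add_one ((b + M) / δ)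
  rw [h] at h1 h2
  have h5 : (a - b) / δ < 1 := by
    rw [show (a - b) / δ = (a + M) / δ - (b + M) / δ by ring]; linarith
  have h6 : -1 < (a - b) / δ := by
    rw [show (a - b) / δ = (a + M) / δ - (b + M) / δ by ring]; linarith
  rw [div_lt_one hδ] at h5
  rw [lt_div_iff₀ hδ] at h6
  exact abs_lt.2 ⟨by linarith, h5⟩

/-- Triangle inequality through the two empirical averages, each of the three gaps being at most
`δ`. -/
theorem abs_sub_le_of_abs_sum_le {L : ℕ} (hL : 0 < L) {δ p q : ℝ} {u v : Fin L → ℝ}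
    (huv : ∀ l, |u l - v l| ≤ δ) (hp : |∑ l, (u l - p)| ≤ L * δ) (hq : |∑ l, (v l - q)| ≤ L * δ) :
    |p - q| ≤ 3 * δ := by
  have hL' : (0 : ℝ) < L := by exact_mod_cast hL
  have h1 : |∑ l, (u l - v l)| ≤ L * δ :=
    (Finset.abs_sum_le_sum_abs _ _).trans (by
      simpa using Finset.sum_le_sum (s := Finset.univ) fun l _ => huv l)
  have h2 : L * (p - q) = ∑ l, (u l - v l) - ∑ l, (u l - p) + ∑ l, (v l - q) := by
    simp only [Finset.sum_sub_distrib, Finset.sum_const, Finset.card_univ, Fintype.card_fin,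
      nsmul_eq_mul]
    ring
  have h3 : L * |p - q| ≤ L * (3 * δ) := by
    rw [← abs_of_pos hL', ← abs_mul, h2, abs_of_pos hL']
    rw [abs_le] at *
    constructor <;> linarith
  exact le_of_mul_le_mul_left h3 hL'

/-! ### Coding measures: from `T` to `T_*` -/

section Covering

variable {K : Type*} [TopologicalSpace K] [CompactSpace K] [MeasurableSpace K] [BorelSpace K]

open Finset in
/-- Measures are coded by the atoms of a short empirical average and the rounded integrals at the few
coordinates where this average is inaccurate. -/
theorem minSubcoverCard_inducedHomeo_le (T : K ≃ₜ K) (s : ℕ → ℕ) (n : ℕ)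
    {W : Set (Set (ProbSpace K))} {A : Finset C(K, ℝ)} {ε : ℝ}
    (hW : ∀ μ, ∃ V ∈ W, ∀ ν,
      (∀ f ∈ A, |integralMap K μ f - integralMap K ν f| < ε) → ν ∈ V)
    {M : ℝ} (hM : ∀ f ∈ A, ∀ x, |f x| ≤ M) {δ : ℝ} (hδ : 0 < δ) (hδε : 3 * δ < ε)
    {U : Set (Set K)} (hU : IsFiniteOpenCover U)
    (hosc : ∀ u ∈ U, ∀ x ∈ u, ∀ y ∈ u, ∀ f ∈ A, |f x - f y| < δ)
    {L b Q : ℕ} (hL : 0 < L) (hb : (#A * n : ℝ) * (2 * M) ^ 2 / (L * δ ^ 2) < b + 1)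
    (hQ : 2 * M / δ < Q) :
    minSubcoverCard (seqJoin (inducedHomeo T) s W n) ≤
      minSubcoverCard (seqJoin T s U n) ^ L *
        Nat.card {h : A × Fin n → Option (Fin Q) // #{c | h c ≠ none} ≤ b} := by
  classical
  obtain ⟨G, hGsub, hGcov, hGcard⟩ :=
    exists_subcover_card_eq (hU.finite_seqJoin T s n) (hU.sUnion_seqJoin T s n)
  have hL' : (0 : ℝ) < L := by exact_mod_cast hL
  let F : A × Fin n → C(K, ℝ) := fun c =>
    c.1.1.comp ⟨(⇑T)^[s c.2], T.continuous.iterate _⟩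
  have hFM : ∀ c x, |F c x| ≤ M := fun c x => hM _ c.1.2 _
  have hmM : ∀ μ c, |integralMap K μ (F c)| ≤ M := fun μ c => by
    simpa [integralMap] using norm_integral_le_of_norm_le_const (μ := (μ.1 : Measure K))
      (f := F c) (C := M) (.of_forall (hFM c))
  choose x hx using fun μ : ProbSpace K => exists_sum_sq_sum_sub_integral_le (μ.1 : Measure K)
    (fun c => ⇑(F c)) (fun c => integrable_continuousMap μ (F c)) hFM L
  have hmem : ∀ y : K, ∃ g : G, y ∈ (g : Set K) := fun y => by
    obtain ⟨g, hg, hy⟩ := mem_sUnion.1 (hGcov ▸ Set.mem_univ y : y ∈ ⋃₀ (G : Set (Set K)))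
    exact ⟨⟨g, hg⟩, hy⟩
  choose g hg using hmem
  have hGosc : ∀ y z, g y = g z → ∀ c, |F c y - F c z| < δ := fun y z hyz c => by
    obtain ⟨u, hu, hgu⟩ := hGsub (g y).2
    have hy : y ∈ ⋂ i : Fin n, (⇑T)^[s i] ⁻¹' u i := hgu ▸ hg y
    have hz : z ∈ ⋂ i : Fin n, (⇑T)^[s i] ⁻¹' u i := hgu ▸ hyz ▸ hg z
    exact hosc _ (hu c.2) _ (mem_iInter.1 hy c.2) _ (mem_iInter.1 hz c.2) _ c.1.2
  have hfloor : ∀ μ c, ⌊(integralMap K μ (F c) + M) / δ⌋₊ < Q := fun μ c => by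
    rw [Nat.floor_lt (div_nonneg (by linarith [abs_le.1 (hmM μ c)]) hδ.le)]
    refine lt_of_le_of_lt ?_ hQ
    gcongr
    linarith [abs_le.1 (hmM μ c)]
  let S : ProbSpace K → A × Fin n → ℝ := fun μ c =>
    ∑ l, (F c (x μ l) - integralMap K μ (F c))
  -- `none` marks an accurate coordinate; elsewhere the integral is stored to precision `δ`.
  let h : ProbSpace K → A × Fin n → Option (Fin Q) := fun μ c =>
    if |S μ c| ≤ L * δ then none else some ⟨_, hfloor μ c⟩
  have hsparse : ∀ μ, #{c | h μ c ≠ none} ≤ b := fun μ => by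
    -- Chebyshev: each inaccurate coordinate contributes at least `(L * δ) ^ 2` to the squared
    -- error.
    have h1 : (#{c | h μ c ≠ none} : ℝ) * (L * δ) ^ 2
        ≤ L * (Fintype.card (A × Fin n) * (2 * M) ^ 2) := by
      refine le_trans ?_ (hx μ)
      rw [← nsmul_eq_mul, ← sum_const]
      refine (sum_le_sum (g := fun c => S μ c ^ 2) fun c hc => ?_).trans
        (sum_le_sum_of_subset_of_nonneg (subset_univ _) fun c _ _ => sq_nonneg _)
      have hc' : L * δ < |S μ c| := by
        by_contra hcon
        exact (mem_filter.1 hc).2 (if_pos (not_lt.1 hcon))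
      rw [← sq_abs (S μ c)]
      gcongr
    have h2 : (#{c | h μ c ≠ none} : ℝ) < b + 1 := by
      refine lt_of_le_of_lt ?_ hb
      rw [le_div_iff₀ (by positivity)]
      refine le_of_mul_le_mul_left ?_ hL'
      simp only [Fintype.card_prod, Fintype.card_coe, Fintype.card_fin, Nat.cast_mul] at h1
      linarith
    exact Nat.lt_succ_iff.1 (by exact_mod_cast h2)
  have hclose : ∀ μ ν, (fun l => g (x μ l)) = (fun l => g (x ν l)) → h μ = h ν →
      ∀ c, |integralMap K μ (F c) - integralMap K ν (F c)| < ε := fun μ ν hgx hh c => by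
    have hc : h μ c = h ν c := congrFun hh c
    simp only [h] at hc
    split_ifs at hc with h1 h2 h2
    · exact (abs_sub_le_of_abs_sum_le hL
        (fun l => (hGosc _ _ (congrFun hgx l) c).le) h1 h2).trans_lt hδε
    · have := abs_sub_lt_of_floor_eq hδ (hmM μ c) (hmM ν c)
        (congrArg Fin.val (Option.some.inj hc))
      linarith
  have hcard : Nat.card ((Fin L → G) ×
      {h : A × Fin n → Option (Fin Q) // #{c | h c ≠ none} ≤ b}) =
      minSubcoverCard (seqJoin T s U n) ^ L *
        Nat.card {h : A × Fin n → Option (Fin Q) // #{c | h c ≠ none} ≤ b} := by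
    rw [Nat.card_prod, Nat.card_fun, Nat.card_eq_fintype_card, Nat.card_eq_fintype_card,
      Fintype.card_coe, Fintype.card_fin, hGcard]
  rw [← hcard]
  refine minSubcoverCard_le_of_code
    (fun μ => (fun l => g (x μ l), ⟨h μ, hsparse μ⟩)) fun μ => ?_
  choose V hV hVmem using hW
  refine ⟨_, ⟨fun i => V ((inducedHomeo T)^[s i] μ), fun _ => hV _, rfl⟩, fun ν hν => ?_⟩
  refine mem_iInter.2 fun i => hVmem _ _ fun f hf => ?_
  have := hclose μ ν (congrArg Prod.fst hν).symm
    (congrArg Subtype.val (congrArg Prod.snd hν)).symm (⟨f, hf⟩, i)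
  simp only [integralMap, integral_pushforward_iterate]
  exact this

variable [T2Space K]

theorem seqEntropyCover_inducedHomeo_le_zero {T : K ≃ₜ K} {s : ℕ → ℕ}
    (h : ∀ U : Set (Set K), IsFiniteOpenCover U → seqEntropyCover T s U ≤ 0)
    {W : Set (Set (ProbSpace K))} (hW : IsFiniteOpenCover W) :
    seqEntropyCover (inducedHomeo T) s W ≤ 0 := by
  obtain ⟨A, ε, hε, hA⟩ := exists_finset_forall_integral_close hW
  set M : ℝ := ∑ f ∈ A, ‖f‖
  have hM : ∀ f ∈ A, ∀ x, |f x| ≤ M := fun f hf x => (f.norm_coe_le_norm x).trans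
    (Finset.single_le_sum (f := fun f : C(K, ℝ) => ‖f‖) (fun _ _ => norm_nonneg _) hf)
  set δ : ℝ := ε / 4 with hδ_def
  have hδ : 0 < δ := by positivity
  obtain ⟨U, hU, hosc⟩ := exists_cover_small_oscillation A hδ
  obtain ⟨Q, hQ⟩ := exists_nat_gt (2 * M / δ)
  refine (seqEntropyCover_le_zero_iff _ s W).2 fun η hη => ?_
  set k : ℝ := (A.card : ℝ)
  -- Order of choices: `t` makes the linear term of the sparse count small, then `L` absorbs `-log
  -- t`, and only then is `n` large. Each of the three costs gets `η / 3`.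
  obtain ⟨t, ht0, ht1, ht⟩ : ∃ t : ℝ, 0 < t ∧ t ≤ 1 ∧ k * (Q * t) ≤ η / 3 := by
    refine ⟨min 1 (η / 3 / (k * Q + 1)), by positivity, min_le_left _ _, ?_⟩
    calc k * (Q * min 1 (η / 3 / (k * Q + 1)))
        ≤ k * (Q * (η / 3 / (k * Q + 1))) := by gcongr; exact min_le_right _ _
      _ = (k * Q) / (k * Q + 1) * (η / 3) := by ring
      _ ≤ 1 * (η / 3) := by
          gcongr
          rw [div_le_one (by positivity)]
          linarith
      _ = η / 3 := one_mul _
  have hlog : 0 ≤ -Real.log t := neg_nonneg.2 (Real.log_nonpos ht0.le ht1)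
  set C : ℝ := k * (2 * M) ^ 2 / δ ^ 2
  obtain ⟨L, hL⟩ := exists_nat_gt (C * -Real.log t / (η / 3))
  have hL' : (0 : ℝ) < L := lt_of_le_of_lt (by positivity) hL
  have hLη : C / L * -Real.log t ≤ η / 3 := by
    rw [div_lt_iff₀ (by positivity)] at hL
    rw [div_mul_eq_mul_div, div_le_iff₀ hL']
    linarith
  filter_upwards [(seqEntropyCover_le_zero_iff T s U).1 (h U hU) (η / 3 / L) (by positivity),
    eventually_gt_atTop 0] with n hn hn0
  have hn' : (0 : ℝ) < n := by exact_mod_cast hn0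
  set b : ℕ := ⌊k * n * (2 * M) ^ 2 / (L * δ ^ 2)⌋₊
  have hb : (b : ℝ) ≤ C / L * n := by
    refine (Nat.floor_le (by positivity)).trans_eq ?_
    simp only [C]
    field_simp
  have hcard := minSubcoverCard_inducedHomeo_le T s n hA hM hδ (by linarith) hU hosc
    (L := L) (b := b) (Q := Q) (by exact_mod_cast hL') (Nat.lt_floor_add_one _) hQ
  have hsparse := log_card_sparse_le (ι := A × Fin n) Q b ht0 ht1
  rw [div_le_iff₀ hn'] at hn ⊢
  set m := minSubcoverCard (seqJoin T s U n)
  set q := Nat.card {h : A × Fin n → Option (Fin Q) // (Finset.univ.filter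
    fun c => h c ≠ none).card ≤ b}
  have hlogle : Real.log (minSubcoverCard (seqJoin (inducedHomeo T) s W n))
      ≤ L * Real.log m + Real.log q := by
    have hm0 := Real.log_natCast_nonneg m
    have hq0 := Real.log_natCast_nonneg q
    rcases Nat.eq_zero_or_pos (minSubcoverCard (seqJoin (inducedHomeo T) s W n)) with h0 | h0
    · rw [h0]
      simp only [Nat.cast_zero, Real.log_zero]
      positivity
    · have hprod : m ^ L * q ≠ 0 := (h0.trans_le hcard).ne'
      calc Real.log (minSubcoverCard (seqJoin (inducedHomeo T) s W n))
          ≤ Real.log ((m : ℝ) ^ L * q) :=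
            Real.log_le_log (by exact_mod_cast h0) (by exact_mod_cast hcard)
        _ = L * Real.log m + Real.log q := by
            rw [Real.log_mul (by exact_mod_cast left_ne_zero_of_mul hprod)
              (by exact_mod_cast right_ne_zero_of_mul hprod), Real.log_pow]
  simp only [Fintype.card_prod, Fintype.card_coe, Fintype.card_fin, Nat.cast_mul] at hsparse
  calc _ ≤ L * Real.log m + Real.log q := hlogle
    _ ≤ L * (η / 3 / L * n) + (k * n * (Q * t) + C / L * n * -Real.log t) := by
        gcongr
        exact hsparse.trans (by gcongr)
    _ = (η / 3 + k * (Q * t) + C / L * -Real.log t) * n := by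
        field_simp
        ring
    _ ≤ (η / 3 + η / 3 + η / 3) * n := by gcongr
    _ = η * n := by ring

theorem isNull_inducedHomeo {T : K ≃ₜ K} (h : IsNull T) : IsNull (inducedHomeo T) := fun s hs =>
  (seqEntropy_eq_zero_iff _ s).2 fun _ hW =>
    seqEntropyCover_inducedHomeo_le_zero ((seqEntropy_eq_zero_iff T s).1 (h s hs)) hW

end Covering

end SeqEntropy

theorem theorem5 {K : Type*} [TopologicalSpace K] [CompactSpace K] [T2Space K]
    [MeasurableSpace K] [BorelSpace K] (T : K ≃ₜ K) :
    SeqEntropy.IsNull T ↔ SeqEntropy.IsNull (SeqEntropy.inducedHomeo T) :=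
  ⟨SeqEntropy.isNull_inducedHomeo, SeqEntropy.isNull_of_isNull_inducedHomeo⟩
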